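/- Let $n \ge 2$ and let $X \subset \mathbb{R}^n$ be any finite set. Then there is a polynomial vector field $g : \mathbb{R}^n \to \mathbb{R}^n$ such that every point of $X$ is an asymptotically stable equilibrium of $\dot x = g(x)$ and $g$ has no other equilibria, i.e. $\{x : g(x) = 0\} = X$. Moreover, $g$ can be taken of the form $g = -\nabla P$, where $P : \mathbb{R}^n \to \mathbb{R}$ is a polynomial function that has a local minimum at each point of $X$ and has no other critical points, i.e. $\{x : \nabla P(x) = 0\} = X$. Here an equilibrium $a$ is asymptotically stable if (i) for every $\varepsilon > 0$ there is $\delta > 0$ such that for every $x_0$ with $|x_0 - a| < \delta$ the solution $x(t)$ of $\dot x = g(x)$, $x(0) = x_0$, exists for all $t \ge 0$ and satisfies $|x(t) - a| < \varepsilon$ for all $t \ge 0$; and (ii) there is $\delta > 0$ such that for every $x_0$ with $|x_0 - a| < \delta$ the solution exists for all $t \ge 0$ and $x(t) \to a$ as $t \to \infty$. -/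

import Mathlib

/-- A function `ℝⁿ → ℝ` is polynomial if it is the evaluation of a real polynomial in the
`n` coordinates. -/
def IsPolynomialFunction {n : ℕ} (P : EuclideanSpace ℝ (Fin n) → ℝ) : Prop :=
  ∃ p : MvPolynomial (Fin n) ℝ, ∀ x : EuclideanSpace ℝ (Fin n),
    P x = MvPolynomial.eval (fun i => x i) p

/-- A vector field on `ℝⁿ` is polynomial if each of its components is a polynomial function. -/
def IsPolynomialVectorField {n : ℕ}
    (g : EuclideanSpace ℝ (Fin n) → EuclideanSpace ℝ (Fin n)) : Prop :=
  ∀ i : Fin n, IsPolynomialFunction (fun x => g x i)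

/-- `a` is an equilibrium of `ẋ = g(x)`. -/
def IsEquilibrium {n : ℕ} (g : EuclideanSpace ℝ (Fin n) → EuclideanSpace ℝ (Fin n))
    (a : EuclideanSpace ℝ (Fin n)) : Prop :=
  g a = 0

/-- `x` restricted to `[0, ∞)` is a solution of `ẋ = g(x)` with initial value `x₀`
(with a one-sided derivative at time `0`). Values at negative times are irrelevant. -/
def IsForwardSolution {n : ℕ} (g : EuclideanSpace ℝ (Fin n) → EuclideanSpace ℝ (Fin n))
    (x₀ : EuclideanSpace ℝ (Fin n)) (x : ℝ → EuclideanSpace ℝ (Fin n)) : Prop :=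
  x 0 = x₀ ∧ IsIntegralCurveOn x (fun _ => g) (Set.Ici 0)

/-- Lyapunov stability of `a`: solutions that start close enough to `a` exist for all
`t ≥ 0` and stay as close to `a` as prescribed. -/
def IsLyapunovStable {n : ℕ} (g : EuclideanSpace ℝ (Fin n) → EuclideanSpace ℝ (Fin n))
    (a : EuclideanSpace ℝ (Fin n)) : Prop :=
  ∀ ε : ℝ, 0 < ε → ∃ δ : ℝ, 0 < δ ∧ ∀ x₀ : EuclideanSpace ℝ (Fin n), dist x₀ a < δ →
    (∃ x : ℝ → EuclideanSpace ℝ (Fin n), IsForwardSolution g x₀ x) ∧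
    ∀ x : ℝ → EuclideanSpace ℝ (Fin n), IsForwardSolution g x₀ x →
      ∀ t : ℝ, 0 ≤ t → dist (x t) a < ε

/-- Local attractivity of `a`: solutions that start close enough to `a` exist for all
`t ≥ 0` and converge to `a` as `t → ∞`. -/
def IsLocallyAttractive {n : ℕ} (g : EuclideanSpace ℝ (Fin n) → EuclideanSpace ℝ (Fin n))
    (a : EuclideanSpace ℝ (Fin n)) : Prop :=
  ∃ δ : ℝ, 0 < δ ∧ ∀ x₀ : EuclideanSpace ℝ (Fin n), dist x₀ a < δ →
    (∃ x : ℝ → EuclideanSpace ℝ (Fin n), IsForwardSolution g x₀ x) ∧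
    ∀ x : ℝ → EuclideanSpace ℝ (Fin n), IsForwardSolution g x₀ x →
      Filter.Tendsto x Filter.atTop (nhds a)

/-- `a` is an asymptotically stable equilibrium of `ẋ = g(x)`. -/
def IsAsymptoticallyStableEquilibrium {n : ℕ}
    (g : EuclideanSpace ℝ (Fin n) → EuclideanSpace ℝ (Fin n))
    (a : EuclideanSpace ℝ (Fin n)) : Prop :=
  IsEquilibrium g a ∧ IsLyapunovStable g a ∧ IsLocallyAttractive g a

/-!
The potential is a sum of squares. Choose a linear form `l` that takes distinct values on `X`, and
let `p` be the monic polynomial whose simple roots are these values. In the coordinates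
`(l, x₁, …)`, set `wᵢ = xᵢ - qᵢ(l)` with interpolation polynomials `qᵢ` still to be fixed, and
`P = p(l)² + (u(l) w₁ - v(l))² + ∑_{i ≥ 2} wᵢ²`, where `u = (p')²` and `v = T + c`, the constant `c`
being such that `v` does not vanish at the roots of `p'`. At a critical point the derivatives
in the directions `wᵢ` give `wᵢ = 0` for `i ≥ 2`, and `u(l) = 0` or `u(l) w₁ = v(l)`. Where `u(l) = 0`,
also `u'(l) = 0`, and the derivative in the direction of `l` is `2 v(l) v'(l) = 2 v(l) ≠ 0`; so this
does not happen. In the other case that derivative is `2 p(l) p'(l)` with `p'(l) ≠ 0`, hence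
`p(l) = 0`. So the critical points are the zeros of `P`
(`sumSqPotential_eq_zero_of_fderiv_eq_zero`), one for each root of `p`, and the `qᵢ` are chosen to
place them at the points of `X` (`exists_polynomial_nonneg_critical`). The empty set is the critical
set of a coordinate function. Two coordinates are needed for `u(l) w₁ - v(l)`.

Stability is the Lyapunov argument with `P` itself as Lyapunov function
(`isAsymptoticallyStableEquilibrium_neg_gradient`). `P` is nonincreasing along solutions of
`ẋ = -χ(x) ∇P(x)` with `χ ≥ 0`, so a solution starting below the minimum of `P` on a small sphere cannot
cross that sphere (`descent_dist_lt`). Taking for `χ` a bump function gives a bounded Lipschitz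
field, whose solutions exist for all positive times
(`exists_isIntegralCurveOn_Ici_of_lipschitzWith`); being trapped where `χ = 1`, they solve the
original equation. Trapped solutions converge to the minimum because `‖∇P‖` is bounded below away
from it (`descent_tendsto`).
-/

section

open Set Metric Filter Topology
open scoped NNReal

/-! ### Existence for all positive times -/

/-- A bounded, globally Lipschitz vector field has a forward solution from every point: the
Picard–Lindelöf theorem applies on each `[0, k]` because boundedness rules out leaving a ball of
radius `M * k`, and by uniqueness these solutions fit together. -/
lemma exists_isIntegralCurveOn_Ici_of_lipschitzWith {E : Type*} [NormedAddCommGroup E]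
    [NormedSpace ℝ E] [CompleteSpace E] {f : E → E} {K M : ℝ≥0} (hK : LipschitzWith K f)
    (hM : ∀ x, ‖f x‖ ≤ M) (x₀ : E) :
    ∃ x : ℝ → E, x 0 = x₀ ∧ IsIntegralCurveOn x (fun _ => f) (Ici 0) := by
  have hloc : ∀ k : ℕ, ∃ α : ℝ → E, α 0 = x₀ ∧
      ∀ t ∈ Icc (0 : ℝ) k, HasDerivWithinAt α (f (α t)) (Icc 0 k) t := fun k =>
    IsPicardLindelof.exists_eq_forall_mem_Icc_hasDerivWithinAt₀ (f := fun _ => f)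
      (t₀ := ⟨(0 : ℝ), le_rfl, Nat.cast_nonneg k⟩) (a := M * k) (L := M) (K := K)
      (.of_time_independent (fun x _ => hM x) hK.lipschitzOnWith (by simp))
  choose α hα0 hα using hloc
  have hright : ∀ {j k : ℕ}, j ≤ k → ∀ t ∈ Ico (0 : ℝ) j,
      HasDerivWithinAt (α k) (f (α k t)) (Ici t) t := fun {j k} hjk t ht => by
    have htk : t < k := ht.2.trans_le (by exact_mod_cast hjk)
    exact ((hα k t ⟨ht.1, htk.le⟩).mono (Icc_subset_Icc_left ht.1)).mono_of_mem_nhdsWithin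
      (Icc_mem_nhdsGE htk)
  have hcont : ∀ {j k : ℕ}, j ≤ k → ContinuousOn (α k) (Icc (0 : ℝ) j) := fun {j k} hjk t ht =>
    ((hα k t ⟨ht.1, ht.2.trans (by exact_mod_cast hjk)⟩).continuousWithinAt).mono
      (Icc_subset_Icc_right (by exact_mod_cast hjk))
  have hle : ∀ {j k : ℕ}, j ≤ k → EqOn (α j) (α k) (Icc (0 : ℝ) j) := fun {j k} hjk =>
    ODE_solution_unique (v := fun _ => f) (fun _ => hK) (hcont le_rfl) (hright le_rfl)
      (hcont hjk) (hright hjk) ((hα0 j).trans (hα0 k).symm)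
  have hagree : ∀ (j k : ℕ) (t : ℝ), 0 ≤ t → t ≤ j → t ≤ k → α j t = α k t := by
    intro j k t h0 hj hk
    rcases le_total j k with h | h
    · exact hle h ⟨h0, hj⟩
    · exact (hle h ⟨h0, hk⟩).symm
  have hlt : ∀ t : ℝ, t < ((⌈t⌉₊ + 1 : ℕ) : ℝ) := fun t => by
    push_cast; linarith [Nat.le_ceil t]
  refine ⟨fun t => α (⌈t⌉₊ + 1) t, hα0 _, fun t ht => ?_⟩
  have h0t : (0 : ℝ) ≤ t := ht
  set m : ℕ := ⌈t⌉₊ + 1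
  have h1 := (hα m t ⟨h0t, (hlt t).le⟩).congr_of_mem
    (f₁ := fun s => α (⌈s⌉₊ + 1) s) (fun s hs => hagree _ _ s hs.1 (hlt s).le hs.2)
    ⟨h0t, (hlt t).le⟩
  refine h1.mono_of_mem_nhdsWithin ?_
  rw [← Ici_inter_Iic]
  exact inter_mem self_mem_nhdsWithin (mem_nhdsWithin_of_mem_nhds (Iic_mem_nhds (hlt t)))

/-! ### Strict minima of a potential attract its descent flow -/

section Descent

variable {E : Type*} [NormedAddCommGroup E] [InnerProductSpace ℝ E] [CompleteSpace E]
  {P χ : E → ℝ} {x : ℝ → E}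

/-- Along a solution of `ẋ = -χ(x) ∇P(x)` the potential grows at rate at most `C` whenever
`-χ ‖∇P‖² ≤ C` on the solution. -/
lemma descent_sub_le (hP : Differentiable ℝ P)
    (hx : IsIntegralCurveOn x (fun _ y => -(χ y • gradient P y)) (Ici 0)) {C : ℝ}
    (hC : ∀ t, 0 ≤ t → -(χ (x t) * ‖gradient P (x t)‖ ^ 2) ≤ C) {s t : ℝ} (hs : 0 ≤ s)
    (hst : s ≤ t) : P (x t) - P (x s) ≤ C * (t - s) := by
  have hd : ∀ τ ∈ Ici (0 : ℝ), HasDerivWithinAt (fun t => P (x t))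
      (-(χ (x τ) * ‖gradient P (x τ)‖ ^ 2)) (Ici 0) τ := fun τ hτ => by
    have h := (hP (x τ)).hasGradientAt.hasFDerivAt.comp_hasDerivWithinAt τ (hx τ hτ)
    refine h.congr_deriv ?_
    rw [InnerProductSpace.toDual_apply_apply, inner_neg_right, inner_smul_right,
      real_inner_self_eq_norm_sq]
  have hd' : ∀ τ ∈ interior (Ici (0 : ℝ)), HasDerivAt (fun t => P (x t))
      (-(χ (x τ) * ‖gradient P (x τ)‖ ^ 2)) τ := fun τ hτ => by
    rw [interior_Ici] at hτ
    exact (hd τ (Ioi_subset_Ici_self hτ)).hasDerivAt (Ici_mem_nhds hτ)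
  refine (convex_Ici 0).image_sub_le_mul_sub_of_deriv_le
    (fun τ hτ => (hd τ hτ).continuousWithinAt)
    (fun τ hτ => (hd' τ hτ).differentiableAt.differentiableWithinAt)
    (fun τ hτ => ?_) s hs t (hs.trans hst) hst
  rw [(hd' τ hτ).deriv]
  exact hC τ (interior_subset hτ)

lemma descent_antitone (hP : Differentiable ℝ P) (hχ : ∀ y, 0 ≤ χ y)
    (hx : IsIntegralCurveOn x (fun _ y => -(χ y • gradient P y)) (Ici 0)) {s t : ℝ} (hs : 0 ≤ s)
    (hst : s ≤ t) : P (x t) ≤ P (x s) := by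
  have := descent_sub_le hP hx (C := 0)
    (fun t _ => neg_nonpos.2 (mul_nonneg (hχ _) (sq_nonneg _))) hs hst
  linarith

/-- Trapping: a solution that starts inside a ball at a level of `P` below all values on the
bounding sphere never reaches that sphere. -/
lemma descent_dist_lt (hP : Differentiable ℝ P) (hχ : ∀ y, 0 ≤ χ y)
    (hx : IsIntegralCurveOn x (fun _ y => -(χ y • gradient P y)) (Ici 0)) {a : E} {r m : ℝ}
    (hm : ∀ y ∈ sphere a r, m ≤ P y) (h0 : dist (x 0) a < r) (hP0 : P (x 0) < m) {t : ℝ}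
    (ht : 0 ≤ t) : dist (x t) a < r := by
  by_contra! h
  have hc : ContinuousOn (fun s => dist (x s) a) (Icc 0 t) := fun s hs =>
    (((hx s hs.1).continuousWithinAt).mono Icc_subset_Ici_self).dist continuousWithinAt_const
  obtain ⟨s, hs, hsr⟩ := intermediate_value_Icc ht hc ⟨h0.le, h⟩
  have h1 := hm (x s) hsr
  have h2 := descent_antitone hP hχ hx le_rfl hs.1
  linarith

variable [ProperSpace E]

/-- A solution of the gradient flow confined to a ball in which the centre `a` is the only zero
and the only critical point of `P ≥ 0` converges to `a`: away from `a` the potential would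
decrease at a rate bounded below, hence become negative. -/
lemma descent_tendsto (hP : Differentiable ℝ P) (hP' : Continuous (gradient P))
    (hx : IsIntegralCurveOn x (fun _ y => -gradient P y) (Ici 0)) {a : E} {r : ℝ}
    (hnn : ∀ y, 0 ≤ P y) (ha : P a = 0)
    (hpos : ∀ y ∈ closedBall a r, y ≠ a → 0 < P y ∧ gradient P y ≠ 0)
    (hr : ∀ t, 0 ≤ t → dist (x t) a < r) : Tendsto x atTop (𝓝 a) := by
  have hx' : IsIntegralCurveOn x (fun _ y => -((1 : ℝ) • gradient P y)) (Ici 0) := by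
    simpa using hx
  rw [Metric.tendsto_atTop]
  intro ε hε
  obtain ⟨m, hm0, hm⟩ := ((isCompact_closedBall a r).diff
    (isOpen_ball (x := a) (ε := ε))).exists_forall_le' (a := 0)
    hP.continuous.continuousOn (fun y hy => (hpos y hy.1 (by
      rintro rfl; exact hy.2 (mem_ball_self hε))).1)
  obtain ⟨T, hT0, hT⟩ : ∃ T, 0 ≤ T ∧ P (x T) < m := by
    by_contra! hge
    obtain ⟨c, hc0, hc⟩ := ((isCompact_closedBall a r).inter_right
      (isClosed_le continuous_const hP.continuous : IsClosed {y | m ≤ P y})).exists_forall_le'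
      (a := 0) (f := fun y => ‖gradient P y‖ ^ 2) (hP'.norm.pow 2).continuousOn (fun y hy => by
        have hya : y ≠ a := by rintro rfl; exact absurd hy.2 (by simpa [ha] using hm0)
        exact pow_pos (norm_pos_iff.2 (hpos y hy.1 hya).2) 2)
    have hT : 0 ≤ P (x 0) / c + 1 := by have := hnn (x 0); positivity
    have h1 := descent_sub_le (χ := fun _ => 1) hP hx' (C := -c) (fun t ht => by
      have := hc (x t) ⟨(hr t ht).le, hge t ht⟩
      simpa using this) le_rfl hT
    have h2 : c * (P (x 0) / c) = P (x 0) := by field_simp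
    have h3 := hnn (x (P (x 0) / c + 1))
    nlinarith
  refine ⟨T, fun t ht => ?_⟩
  by_contra! h
  have h1 := hm (x t) ⟨(hr t (hT0.trans ht)).le, fun h' => absurd h' (not_lt.2 h)⟩
  have h2 := descent_antitone (χ := fun _ => 1) hP (fun _ => zero_le_one) hx' hT0 ht
  linarith

end Descent

lemma ContDiff.gradient_of_succ {E : Type*} [NormedAddCommGroup E] [InnerProductSpace ℝ E]
    [CompleteSpace E] {P : E → ℝ} {k l : WithTop ℕ∞} (hP : ContDiff ℝ l P) (hkl : k + 1 ≤ l) :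
    ContDiff ℝ k (gradient P) :=
  (InnerProductSpace.toDual ℝ E).symm.toContinuousLinearEquiv.contDiff.comp
    (hP.fderiv_right hkl)

/-- An isolated zero of a nonnegative `C²` potential that is also an isolated critical point is
asymptotically stable for the gradient flow. Solutions near it exist for all positive times since
they agree with those of the field cut off outside a ball that they never leave. -/
theorem isAsymptoticallyStableEquilibrium_neg_gradient {n : ℕ} {P : EuclideanSpace ℝ (Fin n) → ℝ}
    (hP : ContDiff ℝ 2 P) (hnn : ∀ y, 0 ≤ P y) {a : EuclideanSpace ℝ (Fin n)} (ha : P a = 0)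
    (hpos : ∀ᶠ y in 𝓝[≠] a, 0 < P y ∧ gradient P y ≠ 0) :
    IsAsymptoticallyStableEquilibrium (fun x => -gradient P x) a := by
  have hPd : Differentiable ℝ P := hP.differentiable (by norm_num)
  have hg : ContDiff ℝ 1 (gradient P) := hP.gradient_of_succ (by norm_num)
  obtain ⟨R, hR, hRpos⟩ : ∃ R > 0, ∀ y ∈ closedBall a R, y ≠ a → 0 < P y ∧ gradient P y ≠ 0 := by
    rw [eventually_nhdsWithin_iff, Metric.eventually_nhds_iff_ball] at hpos
    obtain ⟨ρ, hρ, h⟩ := hpos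
    exact ⟨ρ / 2, half_pos hρ, fun y hy hya =>
      h y (closedBall_subset_ball (half_lt_self hρ) hy) hya⟩
  have hnear : ∀ r, 0 < r → r ≤ R → ∃ m, 0 < m ∧ (∀ y ∈ sphere a r, m ≤ P y) ∧
      ∃ δ, 0 < δ ∧ δ ≤ r ∧ ∀ y, dist y a < δ → P y < m := by
    intro r hr hrR
    obtain ⟨m, hm0, hm⟩ := (isCompact_sphere a r).exists_forall_le' (a := 0)
      hPd.continuous.continuousOn (fun y hy => (hRpos y (closedBall_subset_closedBall hrR
        (sphere_subset_closedBall hy)) (ne_of_mem_sphere hy hr.ne')).1)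
    obtain ⟨δ, hδ, h⟩ := Metric.eventually_nhds_iff.1
      ((hPd.continuous.tendsto a).eventually_lt_const (u := m) (by rwa [ha]))
    exact ⟨m, hm0, hm, min δ r, lt_min hδ hr, min_le_right _ _,
      fun y hy => h (hy.trans_le (min_le_left _ _))⟩
  obtain ⟨mR, -, hmR, δR, hδR, hδRR, hPR⟩ := hnear R hR le_rfl
  have hone : ∀ {x : ℝ → EuclideanSpace ℝ (Fin n)},
      IsIntegralCurveOn x (fun _ y => -gradient P y) (Ici 0) →
      IsIntegralCurveOn x (fun _ y => -((1 : ℝ) • gradient P y)) (Ici 0) := fun h => by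
    simpa using h
  have hexists : ∀ x₀, dist x₀ a < δR → ∃ x, IsForwardSolution (fun x => -gradient P x) x₀ x := by
    intro x₀ hx₀
    let χ : ContDiffBump a := ⟨R, R + 1, hR, by linarith⟩
    have hsupp : HasCompactSupport (fun y => -(χ y • gradient P y)) :=
      (χ.hasCompactSupport.smul_right (f' := gradient P)).neg
    have hsmooth : ContDiff ℝ 1 (fun y => -(χ y • gradient P y)) := (χ.contDiff.smul hg).neg
    obtain ⟨K, hK⟩ := hsmooth.lipschitzWith_of_hasCompactSupport hsupp one_ne_zero
    obtain ⟨M, hM⟩ := hsupp.exists_bound_of_continuous hsmooth.continuous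
    obtain ⟨x, hx0, hx⟩ := exists_isIntegralCurveOn_Ici_of_lipschitzWith hK
      (M := M.toNNReal) (fun y => (hM y).trans (Real.le_coe_toNNReal M)) x₀
    refine ⟨x, hx0, fun t ht => ?_⟩
    -- The trapping lemma applies to the cut-off field itself, and on the ball `χ = 1`.
    have hball := descent_dist_lt hPd (fun y => χ.nonneg' y) hx hmR
      (by rw [hx0]; exact hx₀.trans_le hδRR) (by rw [hx0]; exact hPR _ hx₀) ht
    have h1 : χ (x t) = 1 := χ.one_of_mem_closedBall hball.le
    simpa [h1] using hx t ht
  refine ⟨?_, fun ε hε => ?_, δR, hδR, fun x₀ hx₀ => ⟨hexists x₀ hx₀, fun x hx => ?_⟩⟩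
  · have hmin : IsLocalMin P a := .of_forall fun y => by rw [ha]; exact hnn y
    simp [IsEquilibrium, gradient, hmin.fderiv_eq_zero]
  · obtain ⟨m, -, hm, δ, hδ, hδr, hPm⟩ := hnear (min ε R) (lt_min hε hR) (min_le_right _ _)
    refine ⟨min δ δR, lt_min hδ hδR, fun x₀ hx₀ =>
      ⟨hexists x₀ (hx₀.trans_le (min_le_right _ _)), fun x hx t ht => ?_⟩⟩
    have hx₀' := hx₀.trans_le (min_le_left _ _)
    exact (descent_dist_lt (χ := fun _ => 1) hPd (fun _ => zero_le_one) (hone hx.2) hm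
      (by rw [hx.1]; exact hx₀'.trans_le hδr) (by rw [hx.1]; exact hPm _ hx₀') ht).trans_le
      (min_le_left _ _)
  · refine descent_tendsto hPd hg.continuous hx.2 hnn ha hRpos fun t ht => ?_
    exact descent_dist_lt (χ := fun _ => 1) hPd (fun _ => zero_le_one) (hone hx.2) hmR
      (by rw [hx.1]; exact hx₀.trans_le hδRR) (by rw [hx.1]; exact hPR _ hx₀) ht

end

section

open Polynomial

/-! ### Polynomial functions -/

section IsPolynomialFunction

variable {n : ℕ} {P Q : EuclideanSpace ℝ (Fin n) → ℝ}

lemma isPolynomialFunction_coord (i : Fin n) :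
    IsPolynomialFunction fun x : EuclideanSpace ℝ (Fin n) => x i :=
  ⟨.X i, fun x => by simp⟩

lemma IsPolynomialFunction.add (hP : IsPolynomialFunction P) (hQ : IsPolynomialFunction Q) :
    IsPolynomialFunction fun x => P x + Q x := by
  obtain ⟨p, hp⟩ := hP
  obtain ⟨q, hq⟩ := hQ
  exact ⟨p + q, fun x => by simp [hp, hq]⟩

lemma IsPolynomialFunction.sub (hP : IsPolynomialFunction P) (hQ : IsPolynomialFunction Q) :
    IsPolynomialFunction fun x => P x - Q x := by
  obtain ⟨p, hp⟩ := hP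
  obtain ⟨q, hq⟩ := hQ
  exact ⟨p - q, fun x => by simp [hp, hq]⟩

lemma IsPolynomialFunction.neg (hP : IsPolynomialFunction P) :
    IsPolynomialFunction fun x => -P x := by
  obtain ⟨p, hp⟩ := hP
  exact ⟨-p, fun x => by simp [hp]⟩

lemma IsPolynomialFunction.mul (hP : IsPolynomialFunction P) (hQ : IsPolynomialFunction Q) :
    IsPolynomialFunction fun x => P x * Q x := by
  obtain ⟨p, hp⟩ := hP
  obtain ⟨q, hq⟩ := hQ
  exact ⟨p * q, fun x => by simp [hp, hq]⟩

lemma IsPolynomialFunction.pow (hP : IsPolynomialFunction P) (k : ℕ) :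
    IsPolynomialFunction fun x => P x ^ k := by
  obtain ⟨p, hp⟩ := hP
  exact ⟨p ^ k, fun x => by simp [hp]⟩

lemma IsPolynomialFunction.sum {ι : Type*} {s : Finset ι}
    {F : ι → EuclideanSpace ℝ (Fin n) → ℝ} (hF : ∀ i, IsPolynomialFunction (F i)) :
    IsPolynomialFunction fun x => ∑ i ∈ s, F i x := by
  choose p hp using hF
  exact ⟨∑ i ∈ s, p i, fun x => by simp [hp]⟩

lemma IsPolynomialFunction.eval (hP : IsPolynomialFunction P) (q : ℝ[X]) :
    IsPolynomialFunction fun x => q.eval (P x) := by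
  obtain ⟨p, hp⟩ := hP
  refine ⟨aeval p q, fun x => ?_⟩
  simp only [hp]
  rw [← MvPolynomial.coe_aeval_eq_eval, RingHom.coe_coe, ← Polynomial.aeval_algHom_apply,
    Polynomial.coe_aeval_eq_eval]

lemma isPolynomialFunction_clm (l : EuclideanSpace ℝ (Fin n) →L[ℝ] ℝ) :
    IsPolynomialFunction l := by
  refine ⟨∑ i, .C (l (EuclideanSpace.single i 1)) * .X i, fun x => ?_⟩
  conv_lhs => rw [← (EuclideanSpace.basisFun (Fin n) ℝ).sum_repr x]
  simp [mul_comm]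

lemma MvPolynomial.hasFDerivAt_eval (p : MvPolynomial (Fin n) ℝ) (x : EuclideanSpace ℝ (Fin n)) :
    HasFDerivAt (fun x : EuclideanSpace ℝ (Fin n) => eval (fun i => x i) p)
      (∑ i, eval (fun i => x i) (pderiv i p) •
        (EuclideanSpace.proj i : EuclideanSpace ℝ (Fin n) →L[ℝ] ℝ)) x := by
  induction p using MvPolynomial.induction_on with
  | C a => simpa using hasFDerivAt_const a x
  | add p q hp hq =>
    simp only [map_add, add_smul, Finset.sum_add_distrib]
    exact hp.add hq
  | mul_X p j hp =>
    have hj : HasFDerivAt (fun x : EuclideanSpace ℝ (Fin n) => x j)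
        (EuclideanSpace.proj j : EuclideanSpace ℝ (Fin n) →L[ℝ] ℝ) x :=
      (EuclideanSpace.proj j : EuclideanSpace ℝ (Fin n) →L[ℝ] ℝ).hasFDerivAt
    refine ((hp.mul hj).congr_fderiv ?_).congr_of_eventuallyEq (.of_forall fun y => by simp)
    ext v
    simp [Pi.single_apply, add_mul, Finset.sum_add_distrib, Finset.mul_sum, pderiv_X, apply_ite,
      mul_assoc]

lemma IsPolynomialFunction.contDiff (hP : IsPolynomialFunction P) {k : WithTop ℕ∞} :
    ContDiff ℝ k P := by
  obtain ⟨p, hp⟩ := hP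
  obtain rfl : P = fun x => MvPolynomial.eval (fun i => x i) p := funext hp
  clear hp
  induction p using MvPolynomial.induction_on with
  | C a => simpa using contDiff_const
  | add p q hp hq => simpa using hp.add hq
  | mul_X p j hp =>
    simpa using hp.mul (EuclideanSpace.proj j : EuclideanSpace ℝ (Fin n) →L[ℝ] ℝ).contDiff

lemma gradient_apply_eq_fderiv_single (P : EuclideanSpace ℝ (Fin n) → ℝ)
    (x : EuclideanSpace ℝ (Fin n)) (i : Fin n) :
    gradient P x i = fderiv ℝ P x (EuclideanSpace.single i 1) := by
  rw [← InnerProductSpace.toDual_symm_apply, EuclideanSpace.inner_single_right]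
  simp [gradient]

lemma IsPolynomialFunction.isPolynomialVectorField_gradient (hP : IsPolynomialFunction P) :
    IsPolynomialVectorField (gradient P) := by
  obtain ⟨p, hp⟩ := hP
  obtain rfl : P = fun x => MvPolynomial.eval (fun i => x i) p := funext hp
  refine fun i => ⟨MvPolynomial.pderiv i p, fun x => ?_⟩
  beta_reduce
  rw [gradient_apply_eq_fderiv_single, (p.hasFDerivAt_eval x).fderiv]
  simp

end IsPolynomialFunction

/-! ### A potential with prescribed critical points -/

/-- Linear forms `x ↦ ∑ tⁱ xᵢ` separate the points of a finite set for all but finitely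
many `t`. -/
lemma exists_clm_injOn {m : ℕ} (s : Finset (EuclideanSpace ℝ (Fin (m + 1)))) :
    ∃ l : EuclideanSpace ℝ (Fin (m + 1)) →L[ℝ] ℝ,
      l (EuclideanSpace.single 0 1) = 1 ∧ Set.InjOn l s := by
  classical
  let D : EuclideanSpace ℝ (Fin (m + 1)) → ℝ[X] := fun a => ∑ i, C (a i) * X ^ (i : ℕ)
  have hD : ∀ a, a ≠ 0 → D a ≠ 0 := fun a ha h => ha <| by
    ext i
    have := congrArg (fun q => q.coeff (i : ℕ)) h
    simpa [D, coeff_X_pow, Fin.val_inj] using this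
  have hprod : ∏ ab ∈ s.offDiag, D (ab.1 - ab.2) ≠ 0 := Finset.prod_ne_zero_iff.2 fun ab hab =>
    hD _ (sub_ne_zero.2 (Finset.mem_offDiag.1 hab).2.2)
  obtain ⟨t, ht⟩ : ∃ t, (∏ ab ∈ s.offDiag, D (ab.1 - ab.2)).eval t ≠ 0 := by
    by_contra! h
    exact hprod (Polynomial.funext fun t => by rw [h t, eval_zero])
  refine ⟨∑ i : Fin (m + 1), t ^ (i : ℕ) • EuclideanSpace.proj i, ?_, fun a ha b hb hab => ?_⟩
  · simp
  · by_contra hne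
    rw [eval_prod, Finset.prod_ne_zero_iff] at ht
    refine ht (a, b) (Finset.mem_offDiag.2 ⟨ha, hb, hne⟩) ?_
    have h := sub_eq_zero.2 hab
    rw [← map_sub] at h
    simpa [D, eval_finsetSum, mul_comm (t ^ _)] using h

/-- The sum of squares
`p(l)² + (u(l) w₁ - v(l))² + ∑ᵢ wᵢ²`, where `l` is a linear form, `wᵢ = xᵢ - qᵢ(l)`, and the last
sum runs over the coordinates other than `x₀` and `x₁`. -/
noncomputable def sumSqPotential {m : ℕ} (l : EuclideanSpace ℝ (Fin (m + 2)) →L[ℝ] ℝ)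
    (p u v : ℝ[X]) (q : Fin (m + 2) → ℝ[X]) (x : EuclideanSpace ℝ (Fin (m + 2))) : ℝ :=
  p.eval (l x) ^ 2 + (u.eval (l x) * (x 1 - (q 1).eval (l x)) - v.eval (l x)) ^ 2 +
    ∑ i : Fin m, (x i.succ.succ - (q i.succ.succ).eval (l x)) ^ 2

section sumSqPotential

variable {m : ℕ} (l : EuclideanSpace ℝ (Fin (m + 2)) →L[ℝ] ℝ) (p u v : ℝ[X])
  (q : Fin (m + 2) → ℝ[X])

lemma isPolynomialFunction_sumSqPotential : IsPolynomialFunction (sumSqPotential l p u v q) := by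
  have hl := isPolynomialFunction_clm l
  exact (((hl.eval p).pow 2).add (((((hl.eval u).mul ((isPolynomialFunction_coord 1).sub
    (hl.eval _))).sub (hl.eval v))).pow 2)).add
    (.sum fun i => ((isPolynomialFunction_coord _).sub (hl.eval _)).pow 2)

lemma sumSqPotential_nonneg (x : EuclideanSpace ℝ (Fin (m + 2))) :
    0 ≤ sumSqPotential l p u v q x := by
  unfold sumSqPotential; positivity

lemma sumSqPotential_eq_zero_iff (x : EuclideanSpace ℝ (Fin (m + 2))) :
    sumSqPotential l p u v q x = 0 ↔ p.eval (l x) = 0 ∧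
      u.eval (l x) * (x 1 - (q 1).eval (l x)) = v.eval (l x) ∧
      ∀ i : Fin m, x i.succ.succ = (q i.succ.succ).eval (l x) := by
  unfold sumSqPotential
  rw [add_eq_zero_iff_of_nonneg (by positivity) (by positivity),
    add_eq_zero_iff_of_nonneg (by positivity) (by positivity),
    Finset.sum_eq_zero_iff_of_nonneg (fun _ _ => sq_nonneg _)]
  simp [sub_eq_zero, and_assoc]

lemma fderiv_sumSqPotential (x d : EuclideanSpace ℝ (Fin (m + 2))) :
    fderiv ℝ (sumSqPotential l p u v q) x d =
      2 * p.eval (l x) * ((derivative p).eval (l x) * l d) +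
      2 * (u.eval (l x) * (x 1 - (q 1).eval (l x)) - v.eval (l x)) *
        ((derivative u).eval (l x) * l d * (x 1 - (q 1).eval (l x)) +
          u.eval (l x) * (d 1 - (derivative (q 1)).eval (l x) * l d) -
          (derivative v).eval (l x) * l d) +
      ∑ i : Fin m, 2 * (x i.succ.succ - (q i.succ.succ).eval (l x)) *
        (d i.succ.succ - (derivative (q i.succ.succ)).eval (l x) * l d) := by
  have hdiff : DifferentiableAt ℝ (sumSqPotential l p u v q) x :=
    ((isPolynomialFunction_sumSqPotential l p u v q).contDiff (k := 1)).differentiable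
      one_ne_zero x
  have hline : HasDerivAt (fun s : ℝ => x + s • d) d 0 := by
    simpa using ((hasDerivAt_id (0 : ℝ)).smul_const d).const_add x
  have hl : HasDerivAt (fun s : ℝ => l (x + s • d)) (l d) 0 :=
    l.hasFDerivAt.comp_hasDerivAt 0 hline
  have hc : ∀ i, HasDerivAt (fun s : ℝ => (x + s • d) i) (d i) 0 := fun i =>
    (EuclideanSpace.proj i : EuclideanSpace ℝ (Fin (m + 2)) →L[ℝ] ℝ).hasFDerivAt.comp_hasDerivAt
      0 hline
  have he : ∀ r : ℝ[X], HasDerivAt (fun s : ℝ => r.eval (l (x + s • d)))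
      ((derivative r).eval (l x) * l d) 0 := fun r => by
    have h := (r.hasDerivAt (l (x + (0 : ℝ) • d))).comp (0 : ℝ) hl
    rw [zero_smul, add_zero] at h
    exact h
  have h1 : HasDerivAt (fun s : ℝ => sumSqPotential l p u v q (x + s • d))
      (fderiv ℝ (sumSqPotential l p u v q) x d) 0 := by
    exact hdiff.hasFDerivAt.comp_hasDerivAt_of_eq 0 hline (by simp)
  have h2 := (((he p).pow 2).add ((((he u).mul ((hc 1).sub (he (q 1)))).sub (he v)).pow 2)).add
    (HasDerivAt.fun_sum (u := Finset.univ) fun (i : Fin m) _ =>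
      ((hc i.succ.succ).sub (he (q i.succ.succ))).pow 2)
  refine (h1.unique h2).trans ?_
  simp

/-- With `u = (p')²` and `v = T + c`, `c` such that `p'` and `v` have no common root, every
critical point of the potential is a zero: moving along the level sets of `l` gives `wᵢ = 0` for
`i ≥ 2` and `u(l) (u(l) w₁ - v(l)) = 0`. If `p'(l) = 0`, then `u` and `u'` vanish at `l` and the remaining
derivative is `2 v(l) ≠ 0`; otherwise it is `2 p(l) p'(l)`. -/
lemma sumSqPotential_eq_zero_of_fderiv_eq_zero (hl : l (EuclideanSpace.single 0 1) = 1) {c : ℝ}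
    (hc : ∀ y, (derivative p).eval y = 0 → y + c ≠ 0) {x : EuclideanSpace ℝ (Fin (m + 2))}
    (hx : fderiv ℝ (sumSqPotential l p (derivative p ^ 2) (X + C c) q) x = 0) :
    sumSqPotential l p (derivative p ^ 2) (X + C c) q x = 0 := by
  have hd : ∀ d, _ := fun d =>
    (fderiv_sumSqPotential l p (derivative p ^ 2) (X + C c) q x d).symm.trans
      (by rw [hx]; rfl : _ = (0 : ℝ))
  let e : Fin (m + 2) → EuclideanSpace ℝ (Fin (m + 2)) := fun j =>
    EuclideanSpace.single j 1 - l (EuclideanSpace.single j 1) • EuclideanSpace.single 0 1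
  have hle : ∀ j, l (e j) = 0 := fun j => by simp [e, hl]
  have hw : ∀ i : Fin m, x i.succ.succ = (q i.succ.succ).eval (l x) := fun j => by
    have h1 : (1 : Fin (m + 2)) ≠ j.succ.succ := by simp [Fin.ext_iff]
    have h := hd (e j.succ.succ)
    simp only [hle] at h
    simpa [e, Pi.single_apply, h1, Fin.succ_inj, sub_eq_zero] using h
  have h1 := hd (e 1)
  have h0 := hd (EuclideanSpace.single 0 1)
  simp only [hle] at h1
  simp only [hl, hw] at h0
  have h1' : (derivative p).eval (l x) ^ 2 = 0 ∨
      (derivative p ^ 2).eval (l x) * (x 1 - (q 1).eval (l x)) - (X + C c).eval (l x) = 0 := by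
    have hne : ∀ i : Fin m, i.succ.succ ≠ (1 : Fin (m + 2)) := fun i => by simp [Fin.ext_iff]
    simp [e, hne] at h1 ⊢
    tauto
  rw [sumSqPotential_eq_zero_iff]
  have key : ¬ (derivative p).eval (l x) = 0 := fun hp0 => by
    refine hc _ hp0 ?_
    have h := by simpa [hp0, derivative_pow] using h0
    linarith
  have h3 := h1'.resolve_left (pow_ne_zero 2 key)
  refine ⟨?_, sub_eq_zero.1 h3, hw⟩
  simp only [h3] at h0
  simpa [key] using h0

end sumSqPotential

/-- Every nonempty finite set is the zero set and the critical set of a nonnegative polynomial. -/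
theorem exists_polynomial_nonneg_critical {m : ℕ} (s : Finset (EuclideanSpace ℝ (Fin (m + 2))))
    (hs : s.Nonempty) : ∃ P : EuclideanSpace ℝ (Fin (m + 2)) → ℝ, IsPolynomialFunction P ∧
      (∀ x, 0 ≤ P x) ∧ (∀ x, P x = 0 ↔ x ∈ s) ∧ ∀ x, fderiv ℝ P x = 0 ↔ x ∈ s := by
  classical
  obtain ⟨l, hl0, hl⟩ := exists_clm_injOn s
  set p : ℝ[X] := Lagrange.nodal s l
  have hp' : ∀ a ∈ s, (derivative p).eval (l a) ≠ 0 := fun a ha => by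
    rw [Lagrange.eval_nodal_derivative_eval_node_eq ha, Lagrange.eval_nodal,
      Finset.prod_ne_zero_iff]
    intro b hb
    exact sub_ne_zero.2 fun h => (Finset.mem_erase.1 hb).1
      (hl (Finset.mem_erase.1 hb).2 ha h.symm)
  have hp0 : derivative p ≠ 0 := fun h => by
    obtain ⟨a, ha⟩ := hs
    exact hp' a ha (by simp [h])
  obtain ⟨c, hc⟩ := Infinite.exists_notMem_finset ((derivative p).roots.toFinset.image (- ·))
  have hc' : ∀ y, (derivative p).eval y = 0 → y + c ≠ 0 := fun y hy h => hc <|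
    Finset.mem_image.2 ⟨y, by simp [hp0, hy], by linarith⟩
  -- `q 1` is chosen so that `u(l) w₁ = v(l)` at the points of `s`.
  let q : Fin (m + 2) → ℝ[X] := fun i => Lagrange.interpolate s l fun a =>
    if i = 1 then a 1 - (l a + c) / (derivative p).eval (l a) ^ 2 else a i
  have hq1 : ∀ a ∈ s, (q 1).eval (l a) = a 1 - (l a + c) / (derivative p).eval (l a) ^ 2 :=
    fun a ha => by
    rw [Lagrange.eval_interpolate_at_node _ hl ha, if_pos rfl]
  have hqi : ∀ a ∈ s, ∀ i : Fin m, (q i.succ.succ).eval (l a) = a i.succ.succ := fun a ha i => by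
    have hne : i.succ.succ ≠ (1 : Fin (m + 2)) := by simp [Fin.ext_iff]
    rw [Lagrange.eval_interpolate_at_node _ hl ha, if_neg hne]
  have hzero : ∀ x, sumSqPotential l p (derivative p ^ 2) (X + C c) q x = 0 ↔ x ∈ s := by
    intro x
    rw [sumSqPotential_eq_zero_iff]
    constructor
    · rintro ⟨h, h1, hi⟩
      obtain ⟨a, ha, hax⟩ : ∃ a ∈ s, l x = l a := by
        simpa [p, Lagrange.eval_nodal, Finset.prod_eq_zero_iff, sub_eq_zero] using h
      rw [hax] at h1 hi
      have hxa : ∀ i : Fin (m + 1), x i.succ = a i.succ := by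
        refine Fin.cases ?_ fun i => (hi i).trans (hqi a ha i)
        rw [hq1 a ha] at h1
        have := hp' a ha
        simp only [eval_pow, eval_add, eval_X, eval_C] at h1
        rw [Fin.succ_zero_eq_one]
        refine mul_left_cancel₀ (pow_ne_zero 2 this) ?_
        field_simp at h1
        linarith
      have hsub : x - a = (x 0 - a 0) • EuclideanSpace.single 0 1 := by
        ext i
        refine Fin.cases ?_ (fun i => ?_) i <;> simp [hxa]
      have h0 : x 0 - a 0 = 0 := by
        have := congrArg l hsub
        simpa [hl0, hax] using this.symm
      rw [h0, zero_smul, sub_eq_zero] at hsub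
      exact hsub ▸ ha
    · refine fun hx => ⟨Lagrange.eval_nodal_at_node hx, ?_, fun i => (hqi x hx i).symm⟩
      have := hp' x hx
      rw [hq1 x hx]
      simp only [eval_pow, eval_add, eval_X, eval_C]
      field_simp
      ring
  have hnn := sumSqPotential_nonneg l p (derivative p ^ 2) (X + C c) q
  refine ⟨_, isPolynomialFunction_sumSqPotential l p (derivative p ^ 2) (X + C c) q, hnn, hzero,
    fun x => ⟨fun h => ?_, fun h => ?_⟩⟩
  · exact (hzero x).1 (sumSqPotential_eq_zero_of_fderiv_eq_zero l p q hl0 hc' h)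
  · exact IsLocalMin.fderiv_eq_zero (.of_forall fun y => ((hzero x).2 h).trans_le (hnn y))

end

theorem corollary1 (n : ℕ) (hn : 2 ≤ n) (X : Set (EuclideanSpace ℝ (Fin n))) (hX : X.Finite) :
    ∃ (P : EuclideanSpace ℝ (Fin n) → ℝ)
      (g : EuclideanSpace ℝ (Fin n) → EuclideanSpace ℝ (Fin n)),
      (IsPolynomialFunction P ∧ (∀ a ∈ X, IsLocalMin P a) ∧ {x | gradient P x = 0} = X) ∧
      (∀ x, g x = -gradient P x) ∧
      IsPolynomialVectorField g ∧
      (∀ a ∈ X, IsAsymptoticallyStableEquilibrium g a) ∧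
      {x | IsEquilibrium g x} = X := by
  obtain ⟨m, rfl⟩ : ∃ m, n = m + 2 := ⟨n - 2, by omega⟩
  suffices ∃ P : EuclideanSpace ℝ (Fin (m + 2)) → ℝ,
      IsPolynomialFunction P ∧ (∀ a ∈ X, IsLocalMin P a) ∧ {x | gradient P x = 0} = X ∧
      ∀ a ∈ X, IsAsymptoticallyStableEquilibrium (fun x => -gradient P x) a by
    obtain ⟨P, hP, hmin, hcrit, hstab⟩ := this
    refine ⟨P, fun x => -gradient P x, ⟨hP, hmin, hcrit⟩, fun _ => rfl,
      fun i => (hP.isPolynomialVectorField_gradient i).neg, hstab, ?_⟩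
    simpa [IsEquilibrium] using hcrit
  have hgrad : ∀ (P : EuclideanSpace ℝ (Fin (m + 2)) → ℝ) x, gradient P x = 0 ↔ fderiv ℝ P x = 0 :=
    fun P x => by simp [gradient]
  rcases X.eq_empty_or_nonempty with rfl | hne
  · refine ⟨fun x => x 0, isPolynomialFunction_coord 0, by simp, ?_, by simp⟩
    refine Set.eq_empty_of_forall_notMem fun x hx => ?_
    rw [Set.mem_ofPred_eq, hgrad] at hx
    have h : HasFDerivAt (fun x : EuclideanSpace ℝ (Fin (m + 2)) => x 0)
        (EuclideanSpace.proj 0 : EuclideanSpace ℝ (Fin (m + 2)) →L[ℝ] ℝ) x :=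
      (EuclideanSpace.proj 0 : EuclideanSpace ℝ (Fin (m + 2)) →L[ℝ] ℝ).hasFDerivAt
    rw [h.fderiv] at hx
    simpa using DFunLike.congr_fun hx (EuclideanSpace.single 0 1)
  · lift X to Finset (EuclideanSpace ℝ (Fin (m + 2))) using hX
    obtain ⟨P, hP, hnn, hzero, hcrit⟩ := exists_polynomial_nonneg_critical X (by simpa using hne)
    refine ⟨P, hP, fun a ha => .of_forall fun y => ((hzero a).2 ha).trans_le (hnn y),
      Set.ext fun x => (hgrad P x).trans (hcrit x), fun a ha => ?_⟩
    refine isAsymptoticallyStableEquilibrium_neg_gradient hP.contDiff hnn ((hzero a).2 ha) ?_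
    -- A finite set accumulates nowhere, so near `a` the potential has no zeros or critical
    -- points other than `a`.
    have hev : ∀ᶠ y in nhdsWithin a {a}ᶜ, y ∉ X := by
      have hfin : (↑X \ {a} : Set _).Finite := X.finite_toSet.subset Set.sdiff_subset
      have := hfin.isClosed.isOpen_compl.mem_nhds (x := a) (by simp)
      filter_upwards [mem_nhdsWithin_of_mem_nhds this, self_mem_nhdsWithin] with y hy hya hyX
      exact hy ⟨hyX, hya⟩
    filter_upwards [hev] with y hy
    exact ⟨(hnn y).lt_of_ne fun h => hy ((hzero y).1 h.symm),
      fun h => hy ((hcrit y).1 ((hgrad P y).1 h))⟩
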